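/- Let $d\ge 1$, let $\Omega\subset\mathbb{R}^d$ be a bounded open set, and let $\theta\in\mathbb{R}^d$ with $|\theta|=1$. Let $W_\theta(\Omega)$ be the set of $u\in L^2(\Omega)$ for which there is $v\in L^2(\Omega)$ with $\int_\Omega u\,(\theta\cdot\nabla\varphi)\,dx=-\int_\Omega v\varphi\,dx$ for all $\varphi\in C_c^\infty(\Omega)$. Let $H_\theta=\{y\in\mathbb{R}^d: y\cdot\theta=0\}$, with its $(d-1)$-dimensional Lebesgue measure $\lambda^{d-1}$, let $\mathcal{P}_\theta$ be the orthogonal projection onto $H_\theta$, and for $y\in H_\theta$ let $\omega_\theta(y)=\{s\in\mathbb{R}: s\theta+y\in\Omega\}$, an open set, and let $\mathcal{I}_\theta(y)$ be the set of disjoint nonempty open intervals whose union is $\omega_\theta(y)$. A function $g:\partial\Omega\to\mathbb{R}$ is called a directional trace of $u\in W_\theta(\Omega)$ in the direction $\theta$ if there are a representative of $u$, again denoted by $u$, and a set $A\subset\mathcal{P}_\theta(\Omega)$ such that $\mathcal{P}_\theta(\Omega)\setminus A$ is $\lambda^{d-1}$-negligible and, for every $y\in A$, the function $s\mapsto u(s\theta+y)$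 belongs to $H^1(\omega_\theta(y))$ and, for every $]\alpha,\beta[\,\in\mathcal{I}_\theta(y)$, there is a continuous function $f:\,]\alpha,\beta]\to\mathbb{R}$ with $f(s)=u(s\theta+y)$ for a.e. $s\in\,]\alpha,\beta[$ and $g(\beta\theta+y)=f(\beta)$. The set of all directional traces of $u$ in the direction $\theta$ is denoted by $\gamma_\theta u$. For $x\in\Omega$ let $\delta_\theta(x)=\sup\{s\ge0: x+t\theta\in\Omega\text{ for all }t\in[0,s[\}$ and $\Phi_\theta(x)=x+\delta_\theta(x)\theta\in\partial\Omega$, and let $\mu_\theta$ be the Borel measure on $\partial\Omega$ given by $\mu_\theta(B)=\int_\Omega\chi_B(\Phi_\theta(x))\,dx$ for all Borel sets $B\subset\partial\Omega$. **Theorem.** Let $u\in W_\theta(\Omega)$. 1. If $g$ is a directional trace of $u$ in the direction $\theta$, then a function $\widetilde g:\partial\Omega\to\mathbb{R}$ is a directional trace of $u$ in the direction $\theta$ if and only if $\widetilde g(z)=g(z)$ for $\mu_\theta$-a.e. $z\in\partial\Omega$. 2. Consequently $\gamma_\theta u$ is the equivalence class, for the relation of $\mu_\theta$-a.e. equality on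 functions $\partial\Omega\to\mathbb{R}$, of a Borel measurable function: there is a Borel measurable $g_0:\partial\Omega\to\mathbb{R}$ such that $\gamma_\theta u=\{g:\partial\Omega\to\mathbb{R} \;:\; g=g_0\ \ \mu_\theta\text{-a.e.}\}$. In particular $\gamma_\theta u$ is not empty. -/

import Mathlib

open MeasureTheory Set
open scoped ENNReal

noncomputable section

namespace DirTrace

/-- The Euclidean space `ℝ^d`. -/
abbrev E (d : ℕ) : Type := EuclideanSpace ℝ (Fin d)

variable {d : ℕ}

/-- `φ ∈ C_c^∞(Ω)`, for a function `φ` extended by `0` outside `Ω`. -/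
def IsTestFunction {V : Type*} [NormedAddCommGroup V] [NormedSpace ℝ V]
    (Ω : Set V) (φ : V → ℝ) : Prop :=
  ContDiff ℝ ((⊤ : ℕ∞) : WithTop ℕ∞) φ ∧ HasCompactSupport φ ∧ tsupport φ ⊆ Ω

/-- `v` is the weak derivative of `u` on `Ω` in the direction `θ`. Here `lineDeriv ℝ φ x θ` is the
derivative at `h = 0` of `h ↦ φ (x + h θ)`. -/
def HasWeakDirDeriv (Ω : Set (E d)) (θ : E d) (u v : Lp ℝ 2 (volume.restrict Ω)) : Prop :=
  ∀ φ : E d → ℝ, IsTestFunction Ω φ →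
    ∫ x in Ω, u x * lineDeriv ℝ φ x θ = - ∫ x in Ω, v x * φ x

/-- The space `W_θ(Ω)` of all `u ∈ L²(Ω)` whose weak derivative in the direction `θ` exists and
belongs to `L²(Ω)`. -/
def W (Ω : Set (E d)) (θ : E d) : Set (Lp ℝ 2 (volume.restrict Ω)) :=
  {u | ∃ v : Lp ℝ 2 (volume.restrict Ω), HasWeakDirDeriv Ω θ u v}

/-- The function `f` (more precisely, its class for a.e. equality on `ω`) belongs to the Sobolev
space `H¹(ω)`, `ω` an open subset of `ℝ`. -/
def MemH1 (ω : Set ℝ) (f : ℝ → ℝ) : Prop :=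
  MemLp f 2 (volume.restrict ω) ∧
    ∃ f' : ℝ → ℝ, MemLp f' 2 (volume.restrict ω) ∧
      ∀ φ : ℝ → ℝ, IsTestFunction ω φ →
        ∫ s in ω, f s * deriv φ s = - ∫ s in ω, f' s * φ s

/-- The hyperplane `H_θ` orthogonal to `θ`. -/
abbrev H (θ : E d) : Submodule ℝ (E d) := (ℝ ∙ θ)ᗮ

/-- The Lebesgue measure `λ^{d-1}` of the Euclidean space `H_θ`. The instance is spelled out to
exclude the restriction of the measure of `ℝ^d` to the subtype. -/
def hyperplaneMeasure (θ : E d) : Measure (H θ) :=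
  (measureSpaceOfInnerProductSpace (E := H θ)).volume

/-- The image `P_θ(Ω)` of `Ω` under the orthogonal projection onto `H_θ`. -/
def shadow (Ω : Set (E d)) (θ : E d) : Set (H θ) :=
  (H θ).orthogonalProjectionOnto '' Ω

/-- `ω_θ(y) = {s ∈ ℝ : s θ + y ∈ Ω}`. -/
def slice (Ω : Set (E d)) (θ : E d) (y : H θ) : Set ℝ :=
  {s : ℝ | s • θ + (y : E d) ∈ Ω}

/-- The pairs `(α, β)` such that `]α, β[` is one of the disjoint nonempty bounded open intervals
whose union is `ω`, `ω` a bounded open subset of `ℝ`; see `iUnion_intervals` and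
`pairwiseDisjoint_intervals`. -/
def intervals (ω : Set ℝ) : Set (ℝ × ℝ) :=
  {p | p.1 < p.2 ∧ Ioo p.1 p.2 ⊆ ω ∧ p.1 ∉ ω ∧ p.2 ∉ ω}

theorem iUnion_intervals {ω : Set ℝ} (ho : IsOpen ω) (hb : Bornology.IsBounded ω) :
    ⋃ p ∈ intervals ω, Ioo p.1 p.2 = ω := by
  apply Subset.antisymm
  · exact iUnion₂_subset fun p hp => hp.2.1
  intro s hs
  obtain ⟨R, hR⟩ := hb.subset_ball 0
  have hR' : ∀ t, R ≤ |t| → t ∉ ω := fun t ht h => by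
    have := hR h
    rw [Metric.mem_ball, dist_zero_right, Real.norm_eq_abs] at this
    linarith
  have c1 : IsClosed (ωᶜ ∩ Ici s) := ho.isClosed_compl.inter isClosed_Ici
  have c2 : IsClosed (ωᶜ ∩ Iic s) := ho.isClosed_compl.inter isClosed_Iic
  have n1 : (ωᶜ ∩ Ici s).Nonempty :=
    ⟨max R s, hR' _ ((le_max_left R s).trans (le_abs_self _)), mem_Ici.2 (le_max_right R s)⟩
  have n2 : (ωᶜ ∩ Iic s).Nonempty :=
    ⟨min (-R) s, hR' _ (by have := min_le_left (-R) s; have := neg_abs_le (min (-R) s); linarith),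
      mem_Iic.2 (min_le_right _ _)⟩
  have b1 : BddBelow (ωᶜ ∩ Ici s) := ⟨s, fun t ht => ht.2⟩
  have b2 : BddAbove (ωᶜ ∩ Iic s) := ⟨s, fun t ht => ht.2⟩
  have m1 := c1.csInf_mem n1 b1
  have m2 := c2.csSup_mem n2 b2
  set β := sInf (ωᶜ ∩ Ici s)
  set α := sSup (ωᶜ ∩ Iic s)
  have h1 : s < β := lt_of_le_of_ne m1.2 fun h => m1.1 (h ▸ hs)
  have h2 : α < s := lt_of_le_of_ne m2.2 fun h => m2.1 (h ▸ hs)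
  refine mem_iUnion₂.2 ⟨(α, β), ⟨h2.trans h1, fun t ht => ?_, m2.1, m1.1⟩, h2, h1⟩
  by_contra h
  rcases le_total s t with hst | hst
  · exact absurd ht.2 (not_lt.2 (csInf_le b1 ⟨h, hst⟩))
  · exact absurd ht.1 (not_lt.2 (le_csSup b2 ⟨h, hst⟩))

theorem pairwiseDisjoint_intervals (ω : Set ℝ) :
    (intervals ω).PairwiseDisjoint fun p => Ioo p.1 p.2 := by
  rintro ⟨a, b⟩ ⟨-, hab, ha, hb⟩ ⟨a', b'⟩ ⟨-, hab', ha', hb'⟩ hne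
  refine disjoint_left.2 fun t ht ht' => hne ?_
  simp only [mem_Ioo] at ht ht' ha hb ha' hb'
  have e1 : a = a' := by
    rcases lt_trichotomy a a' with h | h | h
    · exact absurd (hab ⟨h, by linarith⟩) ha'
    · exact h
    · exact absurd (hab' ⟨h, by linarith⟩) ha
  have e2 : b = b' := by
    rcases lt_trichotomy b b' with h | h | h
    · exact absurd (hab' ⟨by linarith, h⟩) hb
    · exact h
    · exact absurd (hab ⟨by linarith, h⟩) hb'
  rw [e1, e2]

/-- `g : ∂Ω → ℝ` is a directional trace of `u` in the direction `θ`: for some representative `w` of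
`u` and some `A ⊆ P_θ(Ω)` with `λ^{d-1}`-negligible complement in `P_θ(Ω)`, the function
`s ↦ w (s θ + y)` belongs to `H¹(ω_θ(y))` for each `y ∈ A` and, for each interval `]α, β[` of
`ω_θ(y)`, it has a continuous representative `f` on `]α, β]` whose value at `β` is `g (β θ + y)`. -/
def IsDirectionalTrace (Ω : Set (E d)) (θ : E d) (u : Lp ℝ 2 (volume.restrict Ω))
    (g : frontier Ω → ℝ) : Prop :=
  ∃ w : E d → ℝ, w =ᵐ[volume.restrict Ω] u ∧
    ∃ A : Set (H θ), A ⊆ shadow Ω θ ∧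
      hyperplaneMeasure θ (shadow Ω θ \ A) = 0 ∧
      ∀ y ∈ A,
        MemH1 (slice Ω θ y) (fun s => w (s • θ + (y : E d))) ∧
        ∀ α β : ℝ, (α, β) ∈ intervals (slice Ω θ y) →
          ∃ f : ℝ → ℝ, ContinuousOn f (Ioc α β) ∧
            (∀ᵐ s ∂(volume.restrict (Ioo α β)), f s = w (s • θ + (y : E d))) ∧
            ∃ z : frontier Ω, (z : E d) = β • θ + (y : E d) ∧ g z = f β

/-- The directional trace `γ_θ u`: the set of all directional traces of `u` in the
direction `θ`. -/
def directionalTrace (Ω : Set (E d)) (θ : E d) (u : Lp ℝ 2 (volume.restrict Ω)) :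
    Set (frontier Ω → ℝ) :=
  {g | IsDirectionalTrace Ω θ u g}

/-- `δ_θ(x) = sup {s ≥ 0 : x + t θ ∈ Ω for all t ∈ [0, s[}`. -/
def exitTime (Ω : Set (E d)) (θ x : E d) : ℝ :=
  sSup {s : ℝ | 0 ≤ s ∧ ∀ t ∈ Ico 0 s, x + t • θ ∈ Ω}

/-- `Φ_θ(x) = x + δ_θ(x) θ`, the first point of `∂Ω` reached from `x ∈ Ω` in the
direction `θ`. -/
def exitPoint (Ω : Set (E d)) (θ x : E d) : E d :=
  x + exitTime Ω θ x • θ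

/-- The directional measure `μ_θ` on `∂Ω` (with its Borel σ-algebra): `μ_θ(A)` is the Lebesgue
measure of `{x ∈ Ω : Φ_θ(x) ∈ A}`; see `directionalMeasure_apply`. -/
def directionalMeasure (Ω : Set (E d)) (θ : E d) : Measure (frontier Ω) :=
  ((volume.restrict Ω).map (exitPoint Ω θ)).comap Subtype.val

theorem exitTime_bddAbove {Ω : Set (E d)} (hb : Bornology.IsBounded Ω) {θ : E d} (hθ : ‖θ‖ = 1)
    (x : E d) : BddAbove {s : ℝ | 0 ≤ s ∧ ∀ t ∈ Ico 0 s, x + t • θ ∈ Ω} := by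
  obtain ⟨R, hR⟩ := hb.subset_ball 0
  refine ⟨|R| + ‖x‖, fun s hs => ?_⟩
  by_contra! h
  have h0 : 0 ≤ |R| + ‖x‖ := by positivity
  have h1 := hR (hs.2 (|R| + ‖x‖) ⟨h0, h⟩)
  rw [Metric.mem_ball, dist_zero_right] at h1
  have h2 : ‖(|R| + ‖x‖) • θ‖ ≤ ‖x + (|R| + ‖x‖) • θ‖ + ‖x‖ := by
    have := norm_sub_le (x + (|R| + ‖x‖) • θ) x
    simpa using this
  rw [norm_smul, hθ, Real.norm_of_nonneg h0] at h2
  linarith [le_abs_self R]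

theorem lt_exitTime_iff {Ω : Set (E d)} (ho : IsOpen Ω) (hb : Bornology.IsBounded Ω) {θ : E d}
    (hθ : ‖θ‖ = 1) (x : E d) {c : ℝ} (hc : 0 ≤ c) :
    c < exitTime Ω θ x ↔ ∀ t ∈ Icc 0 c, x + t • θ ∈ Ω := by
  constructor
  · intro h t ht
    obtain ⟨s, hs, hcs⟩ := exists_lt_of_lt_csSup (by exact ⟨0, le_rfl, by simp⟩) h
    exact hs.2 t ⟨ht.1, ht.2.trans_lt hcs⟩
  · intro h
    have hopen : IsOpen {t : ℝ | x + t • θ ∈ Ω} := ho.preimage (by fun_prop)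
    obtain ⟨ε, hε, hball⟩ := Metric.isOpen_iff.1 hopen c (h c ⟨hc, le_rfl⟩)
    have hmem : c + ε ∈ {s : ℝ | 0 ≤ s ∧ ∀ t ∈ Ico 0 s, x + t • θ ∈ Ω} := by
      refine ⟨by linarith, fun t ht => ?_⟩
      rcases le_total t c with htc | htc
      · exact h t ⟨ht.1, htc⟩
      · refine hball ?_
        rw [Metric.mem_ball, Real.dist_eq, abs_of_nonneg (by linarith)]
        linarith [ht.2]
    exact lt_of_lt_of_le (by linarith) (le_csSup (exitTime_bddAbove hb hθ x) hmem)

theorem exitTime_nonneg (Ω : Set (E d)) (θ x : E d) : 0 ≤ exitTime Ω θ x :=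
  Real.sSup_nonneg fun _ hs => hs.1

theorem measurable_exitPoint {Ω : Set (E d)} (ho : IsOpen Ω) (hb : Bornology.IsBounded Ω)
    {θ : E d} (hθ : ‖θ‖ = 1) : Measurable (exitPoint Ω θ) := by
  have h : Measurable (exitTime Ω θ) := by
    refine measurable_of_Ioi fun c => ?_
    rcases lt_or_ge c 0 with hc | hc
    · have : exitTime Ω θ ⁻¹' Ioi c = univ :=
        eq_univ_of_forall fun x => hc.trans_le (exitTime_nonneg Ω θ x)
      rw [this]
      exact MeasurableSet.univ
    · have hcl : IsClosed (Prod.snd '' {p : Icc (0 : ℝ) c × E d | p.2 + (p.1 : ℝ) • θ ∈ Ωᶜ}) :=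
        isClosedMap_snd_of_compactSpace _ (ho.isClosed_compl.preimage (by fun_prop))
      have : exitTime Ω θ ⁻¹' Ioi c =
          (Prod.snd '' {p : Icc (0 : ℝ) c × E d | p.2 + (p.1 : ℝ) • θ ∈ Ωᶜ})ᶜ := by
        ext x
        rw [mem_preimage, mem_Ioi, lt_exitTime_iff ho hb hθ x hc]
        simp
      rw [this]
      exact hcl.measurableSet.compl
  unfold exitPoint
  exact measurable_id.add (h.smul_const θ)

theorem exitPoint_mem_frontier {Ω : Set (E d)} (ho : IsOpen Ω) (hb : Bornology.IsBounded Ω)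
    {θ : E d} (hθ : ‖θ‖ = 1) {x : E d} (hx : x ∈ Ω) : exitPoint Ω θ x ∈ frontier Ω := by
  have hpos : 0 < exitTime Ω θ x :=
    (lt_exitTime_iff ho hb hθ x le_rfl).2 fun t ht => by
      have : t = 0 := le_antisymm ht.2 ht.1
      simpa [this] using hx
  have hin : ∀ t ∈ Ico 0 (exitTime Ω θ x), x + t • θ ∈ Ω := fun t ht =>
    (lt_exitTime_iff ho hb hθ x ht.1).1 ht.2 t ⟨ht.1, le_rfl⟩
  rw [ho.frontier_eq]
  constructor
  · have hc : Continuous fun t : ℝ => x + t • θ := by fun_prop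
    have hm : exitTime Ω θ x ∈ closure (Ico 0 (exitTime Ω θ x)) := by
      rw [closure_Ico hpos.ne]
      exact ⟨hpos.le, le_rfl⟩
    exact map_mem_closure (f := fun t : ℝ => x + t • θ) hc hm hin
  · intro h
    refine lt_irrefl _ ((lt_exitTime_iff ho hb hθ x hpos.le).2 fun t ht => ?_)
    rcases ht.2.lt_or_eq with h' | h'
    · exact hin t ⟨ht.1, h'⟩
    · rw [h']
      exact h

theorem directionalMeasure_apply {Ω : Set (E d)} (ho : IsOpen Ω) (hb : Bornology.IsBounded Ω)
    {θ : E d} (hθ : ‖θ‖ = 1) {A : Set (frontier Ω)} (hA : MeasurableSet A) :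
    directionalMeasure Ω θ A =
      ∫⁻ x in Ω, (Subtype.val '' A).indicator (fun _ => (1 : ℝ≥0∞)) (exitPoint Ω θ x) := by
  have hF : MeasurableSet (frontier Ω) := isClosed_frontier.measurableSet
  have hA' : MeasurableSet (Subtype.val '' A : Set (E d)) := hF.subtype_image hA
  have hm := measurable_exitPoint ho hb hθ
  rw [directionalMeasure, Measure.comap_apply _ Subtype.val_injective
    (fun s hs => hF.subtype_image hs) _ hA, ← lintegral_indicator_one hA']
  exact lintegral_map (measurable_one.indicator hA') hm

end DirTrace

end

/-
In the coordinates `x = s θ + y` with `y ∈ H_θ`, which preserve Lebesgue measure, testing the weak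
derivative of `u` against products `η(y) ψ(s)` shows that for each `ψ` the integration by parts
formula holds on almost every line. Test functions on all compact subsets of a line are handled by
countably many `ψ`, so on almost every line `u` is in `H¹` and its derivative is `v`; by du
Bois-Reymond it then has a representative which is continuous up to the endpoints of the intervals.

A property holds `μ_θ`-almost everywhere if and only if, for almost every `y`, it holds at all the
points where the line `ℝ θ + y` leaves `Ω`: the points of a whole interval `]α, β[` are sent to the
same `β θ + y`. Hence traces are unique, and may be modified on sets of `μ_θ`-measure zero. The
value at such an exit point `z` is the limit of the averages of `u` over the segments
`[z - h θ, z]`, and this limit is a Borel function of `z`.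
-/

noncomputable section

namespace DirTrace

open Filter Topology

section TestFunction

variable {V : Type*} [NormedAddCommGroup V] [NormedSpace ℝ V] {Ω Ω' : Set V} {φ ψ : V → ℝ}

theorem IsTestFunction.mono (hφ : IsTestFunction Ω φ) (h : Ω ⊆ Ω') : IsTestFunction Ω' φ :=
  ⟨hφ.1, hφ.2.1, hφ.2.2.trans h⟩

theorem IsTestFunction.eq_zero_of_notMem (hφ : IsTestFunction Ω φ) {x : V} (hx : x ∉ Ω) :
    φ x = 0 :=
  image_eq_zero_of_notMem_tsupport fun h => hx (hφ.2.2 h)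

theorem IsTestFunction.sub (hφ : IsTestFunction Ω φ) (hψ : IsTestFunction Ω ψ) :
    IsTestFunction Ω fun x => φ x - ψ x :=
  ⟨hφ.1.sub hψ.1, hφ.2.1.sub hψ.2.1, (tsupport_sub φ ψ).trans (union_subset hφ.2.2 hψ.2.2)⟩

theorem IsTestFunction.const_mul (hφ : IsTestFunction Ω φ) (c : ℝ) :
    IsTestFunction Ω fun x => c * φ x :=
  ⟨contDiff_const.mul hφ.1, hφ.2.1.mul_left, tsupport_mul_subset_right.trans hφ.2.2⟩

theorem IsTestFunction.deriv {ω : Set ℝ} {φ : ℝ → ℝ} (hφ : IsTestFunction ω φ) :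
    IsTestFunction ω (deriv φ) :=
  ⟨(contDiff_infty_iff_deriv.1 hφ.1).2, hφ.2.1.deriv, tsupport_deriv_subset.trans hφ.2.2⟩

theorem IsTestFunction.setIntegral_mul [MeasurableSpace V] {μ : Measure V}
    (hφ : IsTestFunction Ω φ) (f : V → ℝ) : ∫ x in Ω, f x * φ x ∂μ = ∫ x, f x * φ x ∂μ :=
  setIntegral_eq_integral_of_forall_compl_eq_zero fun x hx => by
    rw [hφ.eq_zero_of_notMem hx, mul_zero]

variable [MeasurableSpace V] [BorelSpace V] {μ : Measure V}

theorem IsTestFunction.integrable [IsFiniteMeasureOnCompacts μ] (hφ : IsTestFunction Ω φ) :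
    Integrable φ μ :=
  hφ.1.continuous.integrable_of_hasCompactSupport hφ.2.1

theorem IsTestFunction.integrable_mul (hφ : IsTestFunction Ω φ) {f : V → ℝ}
    (hf : LocallyIntegrableOn f Ω μ) : Integrable (fun x => f x * φ x) μ := by
  obtain ⟨C, hC⟩ := hφ.1.continuous.bounded_above_of_compact_support hφ.2.1
  have hsupp : Function.support (fun x => f x * φ x) ⊆ tsupport φ := fun x hx =>
    subset_tsupport φ (right_ne_zero_of_mul hx)
  exact (integrableOn_iff_integrable_of_support_subset hsupp).1
    ((hf.integrableOn_compact_subset hφ.2.2 hφ.2.1).mul_bdd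
      hφ.1.continuous.aestronglyMeasurable (ae_of_all _ hC))

end TestFunction

section WeakDerivative

variable {a b : ℝ} {ω ω' : Set ℝ} {f f' g g' : ℝ → ℝ}

/-- `f'` is the weak derivative of `f` on the open set `ω ⊆ ℝ`. The integrals may be taken over the
whole line because test functions vanish outside `ω`. -/
def HasWeakDerivOn (ω : Set ℝ) (f f' : ℝ → ℝ) : Prop :=
  ∀ φ, IsTestFunction ω φ → ∫ s, f s * deriv φ s = -∫ s, f' s * φ s

theorem memH1_iff :
    MemH1 ω f ↔ MemLp f 2 (volume.restrict ω) ∧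
      ∃ f', MemLp f' 2 (volume.restrict ω) ∧ HasWeakDerivOn ω f f' := by
  refine and_congr_right fun _ => exists_congr fun k => and_congr_right fun _ =>
    forall₂_congr fun φ hφ => ?_
  rw [hφ.deriv.setIntegral_mul f, hφ.setIntegral_mul k]

theorem HasWeakDerivOn.mono (h : HasWeakDerivOn ω' f f') (hω : ω ⊆ ω') : HasWeakDerivOn ω f f' :=
  fun φ hφ => h φ (hφ.mono hω)

theorem HasWeakDerivOn.sub (hf : HasWeakDerivOn ω f f') (hg : HasWeakDerivOn ω g g')
    (hfi : LocallyIntegrableOn f ω) (hfi' : LocallyIntegrableOn f' ω)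
    (hgi : LocallyIntegrableOn g ω) (hgi' : LocallyIntegrableOn g' ω) :
    HasWeakDerivOn ω (fun s => f s - g s) (fun s => f' s - g' s) := fun φ hφ => by
  simp only [sub_mul]
  rw [integral_sub (hφ.deriv.integrable_mul hfi) (hφ.deriv.integrable_mul hgi),
    integral_sub (hφ.integrable_mul hfi') (hφ.integrable_mul hgi'), hf φ hφ, hg φ hφ]
  ring

theorem hasDerivAt_integral_Iic {ψ : ℝ → ℝ} (hψ : Continuous ψ) (hi : Integrable ψ) (x : ℝ) :
    HasDerivAt (fun x => ∫ t in Iic x, ψ t) (ψ x) x := by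
  have split : (fun x => ∫ t in Iic x, ψ t) = fun x => (∫ t in Iic 0, ψ t) + ∫ t in 0..x, ψ t := by
    funext x
    rw [← intervalIntegral.integral_Iic_sub_Iic hi.integrableOn hi.integrableOn]
    ring
  rw [split]
  exact (intervalIntegral.integral_hasDerivAt_right (hψ.intervalIntegrable _ _)
    (hψ.stronglyMeasurableAtFilter _ _) hψ.continuousAt).const_add _

theorem support_integral_Iic_subset {c d : ℝ} {ψ : ℝ → ℝ}
    (hψ : Function.support ψ ⊆ Icc c d) (h0 : ∫ s, ψ s = 0) :
    Function.support (fun x => ∫ t in Iic x, ψ t) ⊆ Icc c d := fun x hx => by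
  constructor
  · by_contra! hxc
    exact hx (setIntegral_eq_zero_of_forall_eq_zero fun t ht =>
      Function.notMem_support.1 fun h => (hψ h).1.not_gt (ht.out.trans_lt hxc))
  · by_contra! hdx
    exact hx ((setIntegral_eq_integral_of_forall_compl_eq_zero fun t ht =>
      Function.notMem_support.1 fun h => ht ((hψ h).2.trans hdx.le)).trans h0)

theorem IsTestFunction.exists_deriv_eq {ψ : ℝ → ℝ} (hψ : IsTestFunction (Ioo a b) ψ)
    (h0 : ∫ s, ψ s = 0) : ∃ φ, IsTestFunction (Ioo a b) φ ∧ _root_.deriv φ = ψ := by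
  rcases (tsupport ψ).eq_empty_or_nonempty with hempty | hne
  · rw [tsupport_eq_empty_iff] at hempty
    exact ⟨ψ, hψ, by simp [hempty]⟩
  obtain ⟨c, hc⟩ := IsCompact.exists_isLeast hψ.2.1 hne
  obtain ⟨d, hd⟩ := IsCompact.exists_isGreatest hψ.2.1 hne
  have hcd : Function.support ψ ⊆ Icc c d := fun x hx =>
    ⟨hc.2 (subset_tsupport ψ hx), hd.2 (subset_tsupport ψ hx)⟩
  have hsupp := support_integral_Iic_subset hcd h0
  have hder := hasDerivAt_integral_Iic hψ.1.continuous hψ.integrable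
  have hderiv : _root_.deriv (fun x => ∫ t in Iic x, ψ t) = ψ := funext fun x => (hder x).deriv
  refine ⟨_, ⟨?_, .of_support_subset_isCompact isCompact_Icc hsupp, ?_⟩, hderiv⟩
  · rw [contDiff_infty_iff_deriv, hderiv]
    exact ⟨fun x => (hder x).differentiableAt, hψ.1⟩
  · exact (closure_minimal hsupp isClosed_Icc).trans
      (Icc_subset_Ioo (hψ.2.2 hc.1).1 (hψ.2.2 hd.1).2)

theorem exists_isTestFunction_integral_eq_one (hab : a < b) :
    ∃ η, IsTestFunction (Ioo a b) η ∧ ∫ s, η s = 1 := by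
  let β : ContDiffBump ((a + b) / 2) := ⟨(b - a) / 8, (b - a) / 4, by linarith, by linarith⟩
  refine ⟨β.normed volume, ⟨β.contDiff_normed, β.hasCompactSupport_normed, ?_⟩, β.integral_normed⟩
  rw [β.tsupport_normed_eq, Real.closedBall_eq_Icc]
  exact Icc_subset_Ioo (by change a < (a + b) / 2 - (b - a) / 4; linarith)
    (by change (a + b) / 2 + (b - a) / 4 < b; linarith)

theorem HasWeakDerivOn.integral_mul_eq_of_zero (h : HasWeakDerivOn (Ioo a b) f 0)
    (hf : LocallyIntegrableOn f (Ioo a b)) {η ψ : ℝ → ℝ} (hη : IsTestFunction (Ioo a b) η)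
    (hη1 : ∫ s, η s = 1) (hψ : IsTestFunction (Ioo a b) ψ) :
    ∫ s, f s * ψ s = (∫ s, ψ s) * ∫ s, f s * η s := by
  set m := ∫ s, ψ s with hm
  have hψη : IsTestFunction (Ioo a b) fun s => ψ s - m * η s := hψ.sub (hη.const_mul m)
  obtain ⟨φ, hφ, hφ'⟩ := hψη.exists_deriv_eq (by
    rw [integral_sub hψ.integrable (hη.const_mul m).integrable, integral_const_mul, hη1, ← hm,
      mul_one, sub_self])
  have hzero := h φ hφ
  simp only [hφ', mul_sub, mul_left_comm _ m, Pi.zero_apply, zero_mul, integral_zero, neg_zero]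
    at hzero
  rw [integral_sub (hψ.integrable_mul hf) ((hη.integrable_mul hf).const_mul m),
    integral_const_mul] at hzero
  exact sub_eq_zero.1 hzero

theorem HasWeakDerivOn.exists_ae_eq_const (hab : a < b) (h : HasWeakDerivOn (Ioo a b) f 0)
    (hf : LocallyIntegrableOn f (Ioo a b)) :
    ∃ C, ∀ᵐ s ∂volume.restrict (Ioo a b), f s = C := by
  obtain ⟨η, hη, hη1⟩ := exists_isTestFunction_integral_eq_one hab
  refine ⟨∫ s, f s * η s, ?_⟩
  set C := ∫ s, f s * η s
  have hzero : ∀ᵐ s, s ∈ Ioo a b → f s - C = 0 := by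
    refine isOpen_Ioo.ae_eq_zero_of_integral_contDiff_smul_eq_zero
      (hf.sub ((locallyIntegrable_const C).locallyIntegrableOn _)) fun ψ h1 h2 h3 => ?_
    have hψ : IsTestFunction (Ioo a b) ψ := ⟨h1, h2, h3⟩
    calc ∫ s, ψ s • (f s - C) = ∫ s, (f s * ψ s - ψ s * C) := by
          congr 1 with s
          rw [smul_eq_mul]
          ring
      _ = (∫ s, f s * ψ s) - (∫ s, ψ s) * C := by
          rw [integral_sub (hψ.integrable_mul hf) (hψ.integrable.mul_const C), integral_mul_const]
      _ = 0 := by rw [h.integral_mul_eq_of_zero hf hη hη1 hψ, sub_self]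
  rw [ae_restrict_iff' measurableSet_Ioo]
  exact hzero.mono fun s hs hsab => sub_eq_zero.1 (hs hsab)

theorem hasWeakDerivOn_primitive (hf : IntegrableOn f (Ioo a b)) :
    HasWeakDerivOn (Ioo a b) (fun s => ∫ t in a..s, f t) f := fun φ hφ => by
  rcases le_or_gt b a with hba | hab
  · have hφ0 : φ = 0 := funext fun x => hφ.eq_zero_of_notMem (by simp [Ioo_eq_empty_of_le hba])
    simp [hφ0]
  have hfi : IntervalIntegrable f volume a b :=
    (intervalIntegrable_iff_integrableOn_Ioo_of_le hab.le).2 hf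
  have hP := hfi.absolutelyContinuousOnInterval_intervalIntegral (c := a) left_mem_uIcc
  have hφac : AbsolutelyContinuousOnInterval φ a b :=
    ContDiffOn.absolutelyContinuousOnInterval (hφ.1.of_le (by simp)).contDiffOn
  have integral_eq (k : ℝ → ℝ) {χ : ℝ → ℝ} (hχ : IsTestFunction (Ioo a b) χ) :
      ∫ s, k s * χ s = ∫ s in a..b, k s * χ s := by
    rw [intervalIntegral.integral_of_le hab.le, integral_Ioc_eq_integral_Ioo, hχ.setIntegral_mul]
  have hderiv :
      ∫ x in a..b, deriv (fun x => ∫ t in a..x, f t) x * φ x = ∫ x in a..b, f x * φ x := by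
    refine intervalIntegral.integral_congr_ae ?_
    filter_upwards [hfi.ae_hasDerivAt_integral] with x hx hxab
    rw [(hx (uIoc_subset_uIcc hxab) a left_mem_uIcc).deriv]
  rw [integral_eq _ hφ.deriv, integral_eq _ hφ, hP.integral_mul_deriv_eq_deriv_mul hφac, hderiv,
    hφ.eq_zero_of_notMem right_notMem_Ioo, intervalIntegral.integral_same]
  ring

theorem HasWeakDerivOn.exists_continuousOn_ae_eq (hab : a < b) (h : HasWeakDerivOn (Ioo a b) f f')
    (hf : IntegrableOn f (Ioo a b)) (hf' : IntegrableOn f' (Ioo a b)) :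
    ∃ F : ℝ → ℝ, ContinuousOn F (Icc a b) ∧ ∀ᵐ s ∂volume.restrict (Ioo a b), F s = f s := by
  have hPc : ContinuousOn (fun s => ∫ t in a..s, f' t) (Icc a b) := by
    rw [← uIcc_of_le hab.le]
    refine intervalIntegral.continuousOn_primitive_interval ?_
    rwa [uIcc_of_le hab.le, integrableOn_Icc_iff_integrableOn_Ioo]
  have hPi : LocallyIntegrableOn (fun s => ∫ t in a..s, f' t) (Ioo a b) :=
    (hPc.locallyIntegrableOn measurableSet_Icc).mono_set Ioo_subset_Icc_self
  have hfP := h.sub (hasWeakDerivOn_primitive hf') hf.locallyIntegrableOn hf'.locallyIntegrableOn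
    hPi hf'.locallyIntegrableOn
  simp only [sub_self] at hfP
  obtain ⟨C, hC⟩ := hfP.exists_ae_eq_const hab (hf.locallyIntegrableOn.sub hPi)
  refine ⟨fun s => (∫ t in a..s, f' t) + C, hPc.add continuousOn_const, ?_⟩
  filter_upwards [hC] with s hs
  rw [← hs, add_sub_cancel]

theorem MemH1.exists_continuousOn_ae_eq (hf : MemH1 ω f) (hab : a < b) (hω : Ioo a b ⊆ ω) :
    ∃ F : ℝ → ℝ, ContinuousOn F (Icc a b) ∧ ∀ᵐ s ∂volume.restrict (Ioo a b), F s = f s := by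
  obtain ⟨hf2, f', hf2', h⟩ := memH1_iff.1 hf
  have integrableOn {k : ℝ → ℝ} (hk : MemLp k 2 (volume.restrict ω)) : IntegrableOn k (Ioo a b) :=
    (hk.mono_measure (Measure.restrict_mono hω le_rfl)).integrable one_le_two
  exact (h.mono hω).exists_continuousOn_ae_eq hab (integrableOn hf2) (integrableOn hf2')

theorem tendsto_average_left_of_continuousOn {F : ℝ → ℝ} (hab : a < b)
    (hF : ContinuousOn F (Ioc a b)) (hFf : ∀ᵐ s ∂volume.restrict (Ioo a b), F s = f s) :
    Tendsto (fun h => h⁻¹ * ∫ t in Ioo 0 h, f (b - t)) (𝓝[>] 0) (𝓝 (F b)) := by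
  have hG : ContinuousOn (fun t => F (b - t)) (Ico 0 (b - a)) :=
    hF.comp (by fun_prop) fun t ht => ⟨by linarith [ht.2], by linarith [ht.1]⟩
  have hIoi : 𝓝[Ico 0 (b - a)] (0 : ℝ) = 𝓝[≥] 0 := nhdsWithin_Ico_eq_nhdsGE (sub_pos.2 hab)
  have hder : HasDerivWithinAt (fun x => ∫ t in (0 : ℝ)..x, F (b - t)) (F b) (Ici 0) 0 := by
    have hcont := hG 0 ⟨le_rfl, sub_pos.2 hab⟩
    have hmeas := hG.stronglyMeasurableAtFilter_nhdsWithin (μ := volume) measurableSet_Ico 0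
    rw [ContinuousWithinAt, hIoi, sub_zero] at hcont
    rw [hIoi] at hmeas
    exact intervalIntegral.integral_hasDerivWithinAt_of_tendsto_ae_right
      IntervalIntegrable.refl (hmeas.filter_mono (nhdsWithin_mono _ Ioi_subset_Ici_self))
      (hcont.mono_left (inf_le_left.trans (nhdsWithin_mono _ Ioi_subset_Ici_self)))
  have hslope := hasDerivWithinAt_iff_tendsto_slope.1 hder
  rw [Ici_sdiff_left] at hslope
  refine hslope.congr' ?_
  filter_upwards [Ioo_mem_nhdsGT (sub_pos.2 hab)] with h hh
  have hFf' : ∀ᵐ t, b - t ∈ Ioo a b → F (b - t) = f (b - t) :=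
    (Measure.measurePreserving_sub_left volume b).quasiMeasurePreserving.ae
      ((ae_restrict_iff' measurableSet_Ioo).1 hFf)
  rw [slope_def_field, intervalIntegral.integral_same, sub_zero, sub_zero, div_eq_inv_mul,
    intervalIntegral.integral_of_le hh.1.le, integral_Ioc_eq_integral_Ioo]
  congr 1
  refine setIntegral_congr_ae measurableSet_Ioo (hFf'.mono fun t ht htI => ht ?_)
  exact ⟨by linarith [htI.2, hh.2], by linarith [htI.1]⟩

end WeakDerivative

section CountableTests

theorem exists_countable_isCompact_between (X : Type*) [TopologicalSpace X] [T2Space X]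
    [LocallyCompactSpace X] [SecondCountableTopology X] :
    ∃ 𝒦 : Set (Set X), 𝒦.Countable ∧ (∀ K ∈ 𝒦, IsCompact K) ∧
      ∀ L U : Set X, IsCompact L → IsOpen U → L ⊆ U → ∃ K ∈ 𝒦, L ⊆ K ∧ K ⊆ U := by
  let 𝓑 := TopologicalSpace.countableBasis X
  have h𝓑 : TopologicalSpace.IsTopologicalBasis 𝓑 := TopologicalSpace.isBasis_countableBasis X
  refine ⟨{K | IsCompact K} ∩ (fun t => closure (⋃₀ t)) '' {t | t.Finite ∧ t ⊆ 𝓑},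
    ((countable_ofPred_finite_subset (TopologicalSpace.countable_countableBasis X)).image _).mono
      inter_subset_right, fun K hK => hK.1, fun L U hL hU hLU => ?_⟩
  obtain ⟨M, hM, hLM, hMU⟩ := exists_compact_between hL hU hLU
  obtain ⟨S, hS𝓑, hS⟩ := h𝓑.open_eq_sUnion isOpen_interior
  obtain ⟨t, htS, ht, hLt⟩ := hL.elim_finite_subcover_image (b := S) (c := id)
    (fun V hV => h𝓑.isOpen (hS𝓑 hV))
    (by simpa only [id_eq, ← sUnion_eq_biUnion, ← hS] using hLM)
  simp only [id_eq, ← sUnion_eq_biUnion] at hLt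
  have htM : closure (⋃₀ t) ⊆ M := closure_minimal
    (((sUnion_subset_sUnion htS).trans hS.ge).trans interior_subset) hM.isClosed
  exact ⟨closure (⋃₀ t), ⟨hM.of_isClosed_subset isClosed_closure htM, t,
    ⟨ht, htS.trans hS𝓑⟩, rfl⟩, hLt.trans subset_closure, htM.trans hMU⟩

theorem continuous_setIntegral_mul {X : Type*} [TopologicalSpace X] [T2Space X]
    [LocallyCompactSpace X] [SecondCountableTopology X] [MeasurableSpace X] [BorelSpace X]
    {μ : Measure X} {K : Set X} (hK : IsCompact K) {f : X → ℝ} (hf : IntegrableOn f K μ) :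
    Continuous fun p : C(X, ℝ) => ∫ x in K, f x * p x ∂μ := by
  refine continuous_iff_continuousAt.2 fun p₀ => ?_
  obtain ⟨C, hC⟩ := hK.exists_bound_of_continuousOn p₀.continuous.continuousOn
  have hbound : ∀ᶠ p : C(X, ℝ) in 𝓝 p₀, MapsTo p K (Metric.ball (0 : ℝ) (C + 1)) :=
    ContinuousMap.eventually_mapsTo hK Metric.isOpen_ball fun x hx =>
      mem_ball_zero_iff.2 ((hC x hx).trans_lt (lt_add_one C))
  refine continuousAt_of_dominated (bound := fun x => ‖f x‖ * (C + 1)) ?_ ?_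
    (hf.norm.mul_const _) ?_
  · exact Eventually.of_forall fun p => hf.1.mul p.continuous.aestronglyMeasurable
  · filter_upwards [hbound] with p hp
    refine ae_restrict_of_forall_mem hK.measurableSet fun x hx => ?_
    rw [norm_mul]
    exact mul_le_mul_of_nonneg_left (mem_ball_zero_iff.1 (hp hx)).le (norm_nonneg _)
  · exact ae_of_all _ fun x => (continuous_const.mul (continuous_eval_const x)).continuousAt

theorem exists_countable_hasWeakDerivOn_of_isCompact {K : Set ℝ} (hK : IsCompact K) :
    ∃ D : Set (ℝ → ℝ), D.Countable ∧ (∀ ψ ∈ D, IsTestFunction K ψ) ∧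
      ∀ f f' : ℝ → ℝ, IntegrableOn f K → IntegrableOn f' K →
        (∀ ψ ∈ D, ∫ s, f s * deriv ψ s = -∫ s, f' s * ψ s) → HasWeakDerivOn K f f' := by
  -- The topology of locally uniform convergence of `φ` and `φ'` makes both sides continuous in `φ`,
  -- and it is second countable, hence separable.
  let X := {φ : ℝ → ℝ // IsTestFunction K φ}
  let j : X → C(ℝ, ℝ) × C(ℝ, ℝ) := fun φ =>
    (⟨φ, φ.2.1.continuous⟩, ⟨deriv φ, φ.2.deriv.1.continuous⟩)
  let : TopologicalSpace X := .induced j inferInstance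
  have hj : Continuous j := continuous_induced_dom
  have : SecondCountableTopology X := TopologicalSpace.secondCountableTopology_induced _ _ j
  obtain ⟨D, hD, hDense⟩ := TopologicalSpace.exists_countable_dense X
  refine ⟨Subtype.val '' D, hD.image _, forall_mem_image.2 fun φ _ => φ.2,
    fun f f' hf hf' h φ hφ => ?_⟩
  have hleft : Continuous fun φ : X => ∫ s, f s * deriv φ s :=
    ((continuous_setIntegral_mul hK hf).comp (continuous_snd.comp hj)).congr
      fun φ => φ.2.deriv.setIntegral_mul f
  have hright : Continuous fun φ : X => -∫ s, f' s * (φ : ℝ → ℝ) s :=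
    (((continuous_setIntegral_mul hK hf').comp (continuous_fst.comp hj)).congr
      fun φ => φ.2.setIntegral_mul f').neg
  exact congrFun (hleft.ext_on hDense hright fun ψ hψ => h ψ (mem_image_of_mem _ hψ)) ⟨φ, hφ⟩

theorem exists_countable_hasWeakDerivOn :
    ∃ D : Set (ℝ → ℝ), D.Countable ∧ (∀ ψ ∈ D, IsTestFunction univ ψ) ∧
      ∀ (ω : Set ℝ) (f f' : ℝ → ℝ), IsOpen ω → LocallyIntegrableOn f ω →
        LocallyIntegrableOn f' ω →
        (∀ ψ ∈ D, tsupport ψ ⊆ ω → ∫ s, f s * deriv ψ s = -∫ s, f' s * ψ s) →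
        HasWeakDerivOn ω f f' := by
  obtain ⟨𝒦, h𝒦, hcompact, hbetween⟩ := exists_countable_isCompact_between ℝ
  choose! D hD hDtest hDdense using fun K (hK : K ∈ 𝒦) =>
    exists_countable_hasWeakDerivOn_of_isCompact (hcompact K hK)
  refine ⟨⋃ K ∈ 𝒦, D K, h𝒦.biUnion hD, ?_, fun ω f f' hω hf hf' h φ hφ => ?_⟩
  · simp only [mem_iUnion₂]
    rintro ψ ⟨K, hK, hψ⟩
    exact (hDtest K hK ψ hψ).mono (subset_univ K)
  · obtain ⟨K, hK, hφK, hKω⟩ := hbetween _ _ hφ.2.1 hω hφ.2.2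
    exact hDdense K hK f f' (hf.integrableOn_compact_subset hKω (hcompact K hK))
      (hf'.integrableOn_compact_subset hKω (hcompact K hK))
      (fun ψ hψ => h ψ (mem_biUnion hK hψ) ((hDtest K hK ψ hψ).2.2.trans hKω)) φ
      ⟨hφ.1, hφ.2.1, hφK⟩

end CountableTests

variable {d : ℕ} {θ : E d}

section LineCoordinates

/-- The orthogonal projection onto the hyperplane `H_θ`. -/
abbrev proj (θ : E d) : E d →L[ℝ] H θ := (H θ).orthogonalProjectionOnto

/-- The coordinates `(y, s) ↦ s θ + y` of `ℝ^d`, with `y` in the hyperplane `H_θ`. -/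
def linePoint (θ : E d) (p : H θ × ℝ) : E d := p.2 • θ + (p.1 : E d)

theorem continuous_linePoint : Continuous (linePoint θ) := by
  unfold linePoint
  fun_prop

theorem proj_smul_add (s : ℝ) (x : E d) : proj θ (s • θ + x) = proj θ x := by
  rw [map_add, map_smul, Submodule.orthogonalProjectionOnto_orthogonalComplement_singleton_eq_zero,
    smul_zero, zero_add]

theorem proj_smul_add_coe (s : ℝ) (y : H θ) : proj θ (s • θ + (y : E d)) = y := by
  rw [proj_smul_add, Submodule.orthogonalProjectionOnto_mem_subspace_eq_self]

theorem inner_smul_add (hθ : ‖θ‖ = 1) (s : ℝ) (x : E d) :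
    inner ℝ θ (s • θ + x) = s + inner ℝ θ x := by
  rw [inner_add_right, inner_smul_right, real_inner_self_eq_norm_sq, hθ, one_pow, mul_one]

theorem inner_coe_hyperplane (y : H θ) : inner ℝ θ (y : E d) = 0 :=
  Submodule.mem_orthogonal_singleton_iff_inner_right.1 y.2

theorem inner_smul_add_coe (hθ : ‖θ‖ = 1) (s : ℝ) (y : H θ) :
    inner ℝ θ (s • θ + (y : E d)) = s := by
  rw [inner_smul_add hθ, inner_coe_hyperplane, add_zero]

theorem inner_smul_add_proj (hθ : ‖θ‖ = 1) (x : E d) :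
    (inner ℝ θ x : ℝ) • θ + (proj θ x : E d) = x := by
  have h := Submodule.starProjection_add_starProjection_orthogonal (K := ℝ ∙ θ) x
  rwa [Submodule.starProjection_unit_singleton ℝ hθ] at h

/-- The coordinates `(y, s) ↦ s θ + y` as an isometry, the product of `H_θ` and `ℝ` being given its
Euclidean norm. -/
def lineIsometry (hθ : ‖θ‖ = 1) : WithLp 2 (H θ × ℝ) ≃ₗᵢ[ℝ] E d where
  toFun p := linePoint θ p.ofLp
  invFun x := WithLp.toLp 2 (proj θ x, inner ℝ θ x)
  map_add' p q := by
    simp only [linePoint, WithLp.ofLp_add, Prod.fst_add, Prod.snd_add, Submodule.coe_add]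
    module
  map_smul' c p := by
    simp only [linePoint, WithLp.ofLp_smul, Prod.smul_fst, Prod.smul_snd, Submodule.coe_smul,
      RingHom.id_apply, smul_eq_mul]
    module
  left_inv p := by
    simp only [linePoint, proj_smul_add_coe, inner_smul_add_coe hθ]
  right_inv x := inner_smul_add_proj hθ x
  norm_map' p := by
    refine (sq_eq_sq₀ (norm_nonneg _) (norm_nonneg _)).1 ?_
    have horth : inner ℝ (p.snd • θ) (p.fst : E d) = 0 := by
      rw [real_inner_smul_left, inner_coe_hyperplane, mul_zero]
    change ‖p.snd • θ + (p.fst : E d)‖ ^ 2 = ‖p‖ ^ 2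
    rw [WithLp.prod_norm_sq_eq_of_L2, sq, norm_add_sq_eq_norm_sq_add_norm_sq_real horth, norm_smul,
      hθ, Submodule.norm_coe]
    ring

theorem measurePreserving_comp_toLp {U V W : Type*}
    [NormedAddCommGroup U] [InnerProductSpace ℝ U] [FiniteDimensional ℝ U] [MeasurableSpace U]
    [BorelSpace U] [NormedAddCommGroup V] [InnerProductSpace ℝ V] [FiniteDimensional ℝ V]
    [MeasurableSpace V] [BorelSpace V] [NormedAddCommGroup W] [InnerProductSpace ℝ W]
    [FiniteDimensional ℝ W] [MeasurableSpace W] [BorelSpace W]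
    (e : WithLp 2 (U × V) ≃ₗᵢ[ℝ] W) :
    MeasurePreserving (fun p : U × V => e (WithLp.toLp 2 p)) (volume.prod volume) volume :=
  e.measurePreserving.comp (WithLp.volume_preserving_toLp U V)

theorem measurePreserving_linePoint (hθ : ‖θ‖ = 1) :
    MeasurePreserving (linePoint θ) ((hyperplaneMeasure θ).prod volume) volume :=
  measurePreserving_comp_toLp (lineIsometry hθ)

instance : (hyperplaneMeasure θ).IsAddHaarMeasure := by
  unfold hyperplaneMeasure
  infer_instance

theorem ae_ae_line (hθ : ‖θ‖ = 1) {p : E d → Prop} (h : ∀ᵐ x, p x) :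
    ∀ᵐ y : H θ ∂hyperplaneMeasure θ, ∀ᵐ s : ℝ, p (s • θ + (y : E d)) :=
  Measure.ae_ae_of_ae_prod ((measurePreserving_linePoint hθ).quasiMeasurePreserving.ae h)

theorem quasiMeasurePreserving_proj (hθ : ‖θ‖ = 1) :
    Measure.QuasiMeasurePreserving (proj θ) volume (hyperplaneMeasure θ) := by
  refine ⟨(proj θ).continuous.measurable, ?_⟩
  have hfst : proj θ ∘ linePoint θ = Prod.fst := funext fun p => proj_smul_add_coe p.2 p.1
  rw [← (measurePreserving_linePoint hθ).map_eq,
    Measure.map_map (proj θ).continuous.measurable continuous_linePoint.measurable, hfst]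
  exact Measure.quasiMeasurePreserving_fst.absolutelyContinuous

theorem integrable_comp_linePoint (hθ : ‖θ‖ = 1) {F : E d → ℝ} (hF : Integrable F) :
    Integrable (fun p : H θ × ℝ => F (p.2 • θ + (p.1 : E d)))
      ((hyperplaneMeasure θ).prod volume) :=
  (measurePreserving_linePoint hθ).integrable_comp_of_integrable hF

theorem integral_eq_integral_integral_line (hθ : ‖θ‖ = 1) {F : E d → ℝ} (hF : Integrable F) :
    ∫ x, F x = ∫ y, (∫ s : ℝ, F (s • θ + (y : E d))) ∂hyperplaneMeasure θ := by
  have hmp := measurePreserving_linePoint hθ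
  rw [← hmp.map_eq, integral_map hmp.aemeasurable (hmp.map_eq ▸ hF.aestronglyMeasurable)]
  exact integral_prod _ (integrable_comp_linePoint hθ hF)

theorem ae_memLp_two_line (hθ : ‖θ‖ = 1) {F : E d → ℝ} (hF : MemLp F 2) :
    ∀ᵐ y : H θ ∂hyperplaneMeasure θ, MemLp (fun s : ℝ => F (s • θ + (y : E d))) 2 := by
  have hmeas := hF.1.comp_quasiMeasurePreserving
    (measurePreserving_linePoint hθ).quasiMeasurePreserving
  filter_upwards [hmeas.prodMk_left, (integrable_comp_linePoint hθ hF.integrable_sq).prod_right_ae]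
    with y hy hsq
  exact (memLp_two_iff_integrable_sq hy).2 hsq

end LineCoordinates

variable {Ω : Set (E d)}

section ExitPoint

variable {y : H θ} {a b s : ℝ}

theorem isOpen_slice (ho : IsOpen Ω) (y : H θ) : IsOpen (slice Ω θ y) :=
  ho.preimage (by fun_prop)

theorem isBounded_slice (hb : Bornology.IsBounded Ω) (hθ : ‖θ‖ = 1) (y : H θ) :
    Bornology.IsBounded (slice Ω θ y) := by
  obtain ⟨R, hR⟩ := hb.subset_ball 0
  refine (Metric.isBounded_ball (x := (0 : ℝ)) (r := R)).subset fun s hs => ?_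
  rw [mem_ball_zero_iff, Real.norm_eq_abs]
  calc |s| = |inner ℝ θ (s • θ + (y : E d))| := by rw [inner_smul_add_coe hθ]
    _ ≤ ‖θ‖ * ‖s • θ + (y : E d)‖ := abs_real_inner_le_norm _ _
    _ < R := by
      rw [hθ, one_mul]
      exact mem_ball_zero_iff.1 (hR hs)

theorem slice_eq_empty_of_notMem_shadow (hy : y ∉ shadow Ω θ) : slice Ω θ y = ∅ :=
  eq_empty_of_forall_notMem fun s hs => hy ⟨s • θ + (y : E d), hs, proj_smul_add_coe s y⟩

theorem exists_intervals_inner_mem (ho : IsOpen Ω) (hb : Bornology.IsBounded Ω) (hθ : ‖θ‖ = 1)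
    {x : E d} (hx : x ∈ Ω) :
    ∃ a b, (a, b) ∈ intervals (slice Ω θ (proj θ x)) ∧ inner ℝ θ x ∈ Ioo a b := by
  have hmem : (inner ℝ θ x : ℝ) • θ + (proj θ x : E d) ∈ Ω := by rwa [inner_smul_add_proj hθ]
  have hmem' : (inner ℝ θ x : ℝ) ∈ slice Ω θ (proj θ x) := hmem
  rw [← iUnion_intervals (isOpen_slice ho _) (isBounded_slice hb hθ _)] at hmem'
  obtain ⟨p, hp, hxp⟩ := mem_iUnion₂.1 hmem'
  exact ⟨p.1, p.2, hp, hxp⟩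

theorem exitTime_of_mem_intervals (ho : IsOpen Ω) (hb : Bornology.IsBounded Ω) (hθ : ‖θ‖ = 1)
    (hab : (a, b) ∈ intervals (slice Ω θ y)) (hs : s ∈ Ioo a b) :
    exitTime Ω θ (s • θ + (y : E d)) = b - s := by
  obtain ⟨-, hsub, -, hb_notMem⟩ := hab
  have shift (t : ℝ) : s • θ + (y : E d) + t • θ = (s + t) • θ + (y : E d) := by module
  refine eq_of_forall_lt_iff fun c => ?_
  rcases lt_or_ge c 0 with hc | hc
  · exact iff_of_true (hc.trans_le (exitTime_nonneg _ _ _)) (hc.trans (sub_pos.2 hs.2))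
  rw [lt_exitTime_iff ho hb hθ _ hc]
  refine ⟨fun h => ?_, fun h t ht => ?_⟩
  · by_contra! hcb
    have hbΩ := h (b - s) ⟨sub_nonneg.2 hs.2.le, hcb⟩
    rw [shift, add_sub_cancel] at hbΩ
    exact hb_notMem hbΩ
  · rw [shift]
    exact hsub ⟨by linarith [hs.1, ht.1], by linarith [ht.2]⟩

theorem exitPoint_of_mem_intervals (ho : IsOpen Ω) (hb : Bornology.IsBounded Ω) (hθ : ‖θ‖ = 1)
    (hab : (a, b) ∈ intervals (slice Ω θ y)) (hs : s ∈ Ioo a b) :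
    exitPoint Ω θ (s • θ + (y : E d)) = b • θ + (y : E d) := by
  rw [exitPoint, exitTime_of_mem_intervals ho hb hθ hab hs]
  module

theorem endpoint_mem_frontier (ho : IsOpen Ω) (hb : Bornology.IsBounded Ω) (hθ : ‖θ‖ = 1)
    (hab : (a, b) ∈ intervals (slice Ω θ y)) : b • θ + (y : E d) ∈ frontier Ω := by
  obtain ⟨s, hs⟩ := exists_between hab.1
  rw [← exitPoint_of_mem_intervals ho hb hθ hab hs]
  exact exitPoint_mem_frontier ho hb hθ (hab.2.1 hs)

theorem proj_exitPoint (x : E d) : proj θ (exitPoint Ω θ x) = proj θ x := by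
  rw [exitPoint, add_comm, proj_smul_add]

theorem exists_intervals_of_mem_image_exitPoint (ho : IsOpen Ω) (hb : Bornology.IsBounded Ω)
    (hθ : ‖θ‖ = 1) {z : E d} (hz : z ∈ exitPoint Ω θ '' Ω) :
    ∃ a b, (a, b) ∈ intervals (slice Ω θ (proj θ z)) ∧ z = b • θ + (proj θ z : E d) := by
  obtain ⟨x, hx, rfl⟩ := hz
  obtain ⟨a, b, hab, hs⟩ := exists_intervals_inner_mem ho hb hθ hx
  have hexit := exitPoint_of_mem_intervals ho hb hθ hab hs
  rw [inner_smul_add_proj hθ] at hexit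
  rw [proj_exitPoint]
  exact ⟨a, b, hab, hexit⟩

theorem image_exitPoint_eq_iUnion (ho : IsOpen Ω) (hb : Bornology.IsBounded Ω) (hθ : ‖θ‖ = 1) :
    exitPoint Ω θ '' Ω = ⋃ n : ℕ, {z | z - (1 / ((n : ℝ) + 1)) • θ ∈ Ω ∧
      exitPoint Ω θ (z - (1 / ((n : ℝ) + 1)) • θ) = z} := by
  refine Subset.antisymm (fun z hz => ?_) (iUnion_subset fun n z hz => ⟨_, hz.1, hz.2⟩)
  obtain ⟨a, b, hab, hzb⟩ := exists_intervals_of_mem_image_exitPoint ho hb hθ hz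
  obtain ⟨n, hn⟩ := exists_nat_one_div_lt (sub_pos.2 hab.1)
  set ε := 1 / ((n : ℝ) + 1)
  have hs : b - ε ∈ Ioo a b := ⟨lt_sub_comm.1 hn, sub_lt_self b Nat.one_div_pos_of_nat⟩
  have hzs : z - ε • θ = (b - ε) • θ + (proj θ z : E d) := by
    nth_rewrite 1 [hzb]
    module
  refine mem_iUnion.2 ⟨n, ?_⟩
  rw [mem_ofPred_eq, hzs, exitPoint_of_mem_intervals ho hb hθ hab hs, ← hzb]
  exact ⟨hab.2.1 hs, rfl⟩

theorem measurableSet_image_exitPoint (ho : IsOpen Ω) (hb : Bornology.IsBounded Ω)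
    (hθ : ‖θ‖ = 1) : MeasurableSet (exitPoint Ω θ '' Ω) := by
  rw [image_exitPoint_eq_iUnion ho hb hθ]
  refine MeasurableSet.iUnion fun n => ?_
  have hshift : Measurable fun z : E d => z - (1 / ((n : ℝ) + 1)) • θ := by fun_prop
  exact (hshift ho.measurableSet).inter
    (measurableSet_eq_fun ((measurable_exitPoint ho hb hθ).comp hshift) measurable_id)

/-- The points of `∂Ω` at which the line `ℝ θ + y`, travelled in the direction `θ`, leaves `Ω`: the
points `β θ + y` with `]α, β[` one of the intervals of `ω_θ(y)`. -/
def lineExits (Ω : Set (E d)) (θ : E d) (y : H θ) : Set (frontier Ω) :=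
  {z | ∃ a b, (a, b) ∈ intervals (slice Ω θ y) ∧ (z : E d) = b • θ + (y : E d)}

theorem ae_directionalMeasure_iff_ae_map {p : frontier Ω → Prop} :
    (∀ᵐ z : frontier Ω ∂directionalMeasure Ω θ, p z) ↔
      ∀ᵐ x ∂(volume.restrict Ω).map (exitPoint Ω θ), ∀ z : frontier Ω, (z : E d) = x → p z := by
  let q (x : E d) : Prop := ∀ z : frontier Ω, (z : E d) = x → p z
  have hF : MeasurableSet (frontier Ω) := isClosed_frontier.measurableSet
  calc (∀ᵐ z : frontier Ω ∂directionalMeasure Ω θ, p z) ↔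
        ∀ᵐ z : frontier Ω ∂directionalMeasure Ω θ, q z :=
        eventually_congr <| Eventually.of_forall fun z =>
          ⟨fun h z' hz' => (Subtype.ext hz' : z' = z) ▸ h, fun h => h z rfl⟩
    _ ↔ ∀ᵐ x ∂(volume.restrict Ω).map (exitPoint Ω θ), x ∈ frontier Ω → q x := by
        rw [← ae_restrict_iff' hF, ae_restrict_iff_subtype hF]
        rfl
    _ ↔ ∀ᵐ x ∂(volume.restrict Ω).map (exitPoint Ω θ), q x :=
        eventually_congr <| Eventually.of_forall fun x =>
          ⟨fun h z hz => h (hz ▸ z.2) z hz, fun h _ => h⟩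

theorem ae_lineExits_of_ae_directionalMeasure (ho : IsOpen Ω) (hb : Bornology.IsBounded Ω)
    (hθ : ‖θ‖ = 1) {p : frontier Ω → Prop} (h : ∀ᵐ z : frontier Ω ∂directionalMeasure Ω θ, p z) :
    ∀ᵐ y : H θ ∂hyperplaneMeasure θ, ∀ z ∈ lineExits Ω θ y, p z := by
  have hΩ : ∀ᵐ x, x ∈ Ω → ∀ z : frontier Ω, (z : E d) = exitPoint Ω θ x → p z :=
    (ae_restrict_iff' ho.measurableSet).1 <|
      ae_of_ae_map (measurable_exitPoint ho hb hθ).aemeasurable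
        (ae_directionalMeasure_iff_ae_map.1 h)
  filter_upwards [ae_ae_line hθ hΩ] with y hy
  rintro z ⟨a, b, hab, hz⟩
  have hIoo : ∀ᵐ _ : ℝ ∂volume.restrict (Ioo a b), p z :=
    (ae_restrict_iff' measurableSet_Ioo).2 <| hy.mono fun s hs hsab =>
      hs (hab.2.1 hsab) z (hz.trans (exitPoint_of_mem_intervals ho hb hθ hab hsab).symm)
  have : (ae (volume.restrict (Ioo a b))).NeBot := ae_restrict_neBot.2 <| by
    rw [Real.volume_Ioo]
    exact (ENNReal.ofReal_pos.2 (sub_pos.2 hab.1)).ne'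
  exact eventually_const.1 hIoo

theorem ae_directionalMeasure_of_ae_lineExits (ho : IsOpen Ω) (hb : Bornology.IsBounded Ω)
    (hθ : ‖θ‖ = 1) {p : frontier Ω → Prop}
    (h : ∀ᵐ y : H θ ∂hyperplaneMeasure θ, ∀ z ∈ lineExits Ω θ y, p z) :
    ∀ᵐ z : frontier Ω ∂directionalMeasure Ω θ, p z := by
  obtain ⟨N, hN, hNmeas, hN0⟩ := exists_measurable_superset_of_null (ae_iff.1 h)
  have hexit : ∀ᵐ x ∂(volume.restrict Ω).map (exitPoint Ω θ),
      x ∈ exitPoint Ω θ '' Ω ∩ (proj θ ⁻¹' N)ᶜ := by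
    refine (ae_map_iff (measurable_exitPoint ho hb hθ).aemeasurable
      ((measurableSet_image_exitPoint ho hb hθ).inter
        ((proj θ).continuous.measurable hNmeas).compl)).2 ?_
    filter_upwards [ae_restrict_mem ho.measurableSet,
      ae_restrict_of_ae ((quasiMeasurePreserving_proj hθ).ae (measure_eq_zero_iff_ae_notMem.1 hN0))]
      with x hx hxN
    refine ⟨mem_image_of_mem _ hx, ?_⟩
    rwa [mem_compl_iff, mem_preimage, proj_exitPoint]
  refine ae_directionalMeasure_iff_ae_map.2 (hexit.mono ?_)
  rintro _ ⟨hz, hzN⟩ z rfl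
  by_contra hp
  exact hzN (hN fun hall => hp (hall z (exists_intervals_of_mem_image_exitPoint ho hb hθ hz)))

end ExitPoint

section Slicing

variable {U V : E d → ℝ} {η : H θ → ℝ} {ψ : ℝ → ℝ} {S : Set (H θ)} {T : Set ℝ}

theorem IsTestFunction.tensor (hθ : ‖θ‖ = 1) (hη : IsTestFunction S η) (hψ : IsTestFunction T ψ)
    (hST : ∀ y ∈ S, ∀ s ∈ T, s • θ + (y : E d) ∈ Ω) :
    IsTestFunction Ω fun x => η (proj θ x) * ψ (inner ℝ θ x) := by
  set C := linePoint θ '' (tsupport η ×ˢ tsupport ψ)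
  have hC : IsCompact C := (IsCompact.prod hη.2.1 hψ.2.1).image continuous_linePoint
  have hsupp : Function.support (fun x => η (proj θ x) * ψ (inner ℝ θ x)) ⊆ C := fun x hx =>
    ⟨(proj θ x, inner ℝ θ x), ⟨subset_tsupport _ (left_ne_zero_of_mul hx),
      subset_tsupport _ (right_ne_zero_of_mul hx)⟩, inner_smul_add_proj hθ x⟩
  refine ⟨(hη.1.comp (proj θ).contDiff).mul (hψ.1.comp (contDiff_const.inner ℝ contDiff_id)),
    .of_support_subset_isCompact hC hsupp, (closure_minimal hsupp hC.isClosed).trans ?_⟩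
  rintro _ ⟨⟨y, s⟩, ⟨hy, hs⟩, rfl⟩
  exact hST y (hη.2.2 hy) s (hψ.2.2 hs)

theorem lineDeriv_tensor (hθ : ‖θ‖ = 1) (η : H θ → ℝ) (ψ : ℝ → ℝ) (x : E d) :
    lineDeriv ℝ (fun x => η (proj θ x) * ψ (inner ℝ θ x)) x θ =
      η (proj θ x) * deriv ψ (inner ℝ θ x) := by
  have hline : (fun t : ℝ => η (proj θ (x + t • θ)) * ψ (inner ℝ θ (x + t • θ))) =
      fun t => η (proj θ x) * ψ (t + inner ℝ θ x) := by
    funext t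
    rw [add_comm x, proj_smul_add, inner_smul_add hθ]
  rw [lineDeriv, hline, deriv_const_mul_field, deriv_comp_add_const, zero_add]

theorem integrable_integral_line_mul (hθ : ‖θ‖ = 1) (hU : Integrable U) (hψ : IsTestFunction T ψ) :
    Integrable (fun y : H θ => ∫ s, U (s • θ + (y : E d)) * ψ s) (hyperplaneMeasure θ) := by
  obtain ⟨C, hC⟩ := hψ.1.continuous.bounded_above_of_compact_support hψ.2.1
  have hcont : Continuous fun x : E d => ψ (inner ℝ θ x) :=
    hψ.1.continuous.comp (continuous_const.inner continuous_id)
  have hmul : Integrable fun x => U x * ψ (inner ℝ θ x) :=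
    hU.mul_bdd hcont.aestronglyMeasurable (ae_of_all _ fun x => hC _)
  simpa only [inner_smul_add_coe hθ] using (integrable_comp_linePoint hθ hmul).integral_prod_left

theorem integral_mul_tensor (hθ : ‖θ‖ = 1) (hU : Integrable U) (hη : IsTestFunction S η)
    (hψ : IsTestFunction T ψ) :
    ∫ x, U x * (η (proj θ x) * ψ (inner ℝ θ x)) =
      ∫ y : H θ, (η y * ∫ s, U (s • θ + (y : E d)) * ψ s) ∂hyperplaneMeasure θ := by
  have htensor : IsTestFunction univ fun x => η (proj θ x) * ψ (inner ℝ θ x) :=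
    hη.tensor hθ hψ fun _ _ _ _ => mem_univ _
  rw [integral_eq_integral_integral_line hθ
    (htensor.integrable_mul (hU.locallyIntegrable.locallyIntegrableOn univ))]
  simp only [proj_smul_add_coe, inner_smul_add_coe hθ, mul_left_comm _ (η _), integral_const_mul]

theorem isOpen_setOf_subset_slice (ho : IsOpen Ω) {K : Set ℝ} (hK : IsCompact K) :
    IsOpen {y : H θ | K ⊆ slice Ω θ y} :=
  isOpen_iff_mem_nhds.2 fun _ hy => hK.eventually_forall_of_forall_eventually fun _ hs =>
    continuous_linePoint.continuousAt.eventually (ho.mem_nhds (hy hs))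

/-- `V` is the weak derivative of `U` on `Ω` in the direction `θ`, for functions defined on the
whole space. -/
def HasWeakLineDerivOn (Ω : Set (E d)) (θ : E d) (U V : E d → ℝ) : Prop :=
  ∀ φ, IsTestFunction Ω φ → ∫ x, U x * lineDeriv ℝ φ x θ = -∫ x, V x * φ x

theorem HasWeakLineDerivOn.ae_integral_line (h : HasWeakLineDerivOn Ω θ U V) (ho : IsOpen Ω)
    (hθ : ‖θ‖ = 1) (hU : Integrable U) (hV : Integrable V) (hψ : IsTestFunction T ψ) :
    ∀ᵐ y : H θ ∂hyperplaneMeasure θ, tsupport ψ ⊆ slice Ω θ y →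
      ∫ s, U (s • θ + (y : E d)) * deriv ψ s = -∫ s, V (s • θ + (y : E d)) * ψ s := by
  have hA := integrable_integral_line_mul hθ hU hψ.deriv
  have hB := integrable_integral_line_mul hθ hV hψ
  have hzero := (isOpen_setOf_subset_slice ho hψ.2.1).ae_eq_zero_of_integral_contDiff_smul_eq_zero
    ((hA.add hB).locallyIntegrable.locallyIntegrableOn _) fun η h1 h2 h3 => ?_
  · exact hzero.mono fun y hy hψy => eq_neg_of_add_eq_zero_left (hy hψy)
  have hη : IsTestFunction {y : H θ | tsupport ψ ⊆ slice Ω θ y} η := ⟨h1, h2, h3⟩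
  have hψ' : IsTestFunction (tsupport ψ) ψ := ⟨hψ.1, hψ.2.1, Subset.rfl⟩
  have htest := h _ (hη.tensor hθ hψ' fun y hy s hs => hy hs)
  simp only [lineDeriv_tensor hθ] at htest
  rw [integral_mul_tensor hθ hU hη hψ.deriv, integral_mul_tensor hθ hV hη hψ] at htest
  have hηA := hη.integrable_mul (hA.locallyIntegrable.locallyIntegrableOn _)
  have hηB := hη.integrable_mul (hB.locallyIntegrable.locallyIntegrableOn _)
  simp only [mul_comm _ (η _)] at hηA hηB
  simp only [Pi.add_apply, smul_eq_mul, mul_add]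
  rw [integral_add hηA hηB, htest, neg_add_cancel]

theorem HasWeakLineDerivOn.ae_hasWeakDerivOn_slice (h : HasWeakLineDerivOn Ω θ U V) (ho : IsOpen Ω)
    (hθ : ‖θ‖ = 1) (hU : Integrable U) (hV : Integrable V) :
    ∀ᵐ y : H θ ∂hyperplaneMeasure θ, HasWeakDerivOn (slice Ω θ y)
      (fun s => U (s • θ + (y : E d))) (fun s => V (s • θ + (y : E d))) := by
  obtain ⟨D, hD, hDtest, hDsuff⟩ := exists_countable_hasWeakDerivOn
  have htests := (ae_ball_iff hD).2 fun ψ hψ => h.ae_integral_line ho hθ hU hV (hDtest ψ hψ)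
  filter_upwards [htests, (integrable_comp_linePoint hθ hU).prod_right_ae,
    (integrable_comp_linePoint hθ hV).prod_right_ae] with y hy hUy hVy
  exact hDsuff _ _ _ (isOpen_slice ho y) (hUy.locallyIntegrable.locallyIntegrableOn _)
    (hVy.locallyIntegrable.locallyIntegrableOn _) hy

theorem HasWeakLineDerivOn.ae_memH1_slice (h : HasWeakLineDerivOn Ω θ U V) (ho : IsOpen Ω)
    (hθ : ‖θ‖ = 1) (hU : Integrable U) (hV : Integrable V) (hU2 : MemLp U 2) (hV2 : MemLp V 2) :
    ∀ᵐ y : H θ ∂hyperplaneMeasure θ, MemH1 (slice Ω θ y) fun s => U (s • θ + (y : E d)) := by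
  filter_upwards [h.ae_hasWeakDerivOn_slice ho hθ hU hV, ae_memLp_two_line hθ hU2,
    ae_memLp_two_line hθ hV2] with y hy hUy hVy
  exact memH1_iff.2 ⟨hUy.restrict _, _, hVy.restrict _, hy⟩

end Slicing

section Trace

variable {u v : Lp ℝ 2 (volume.restrict Ω)} {U w w' : E d → ℝ} {g g' : frontier Ω → ℝ} {y : H θ}

/-- On the line `ℝ θ + y`, the function `g` is a trace of the representative `w`: this is the
condition imposed by `IsDirectionalTrace` on the points `y` of the set `A`. -/
def IsTraceOnLine (Ω : Set (E d)) (θ : E d) (w : E d → ℝ) (g : frontier Ω → ℝ) (y : H θ) : Prop :=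
  MemH1 (slice Ω θ y) (fun s => w (s • θ + (y : E d))) ∧
    ∀ α β : ℝ, (α, β) ∈ intervals (slice Ω θ y) →
      ∃ f : ℝ → ℝ, ContinuousOn f (Ioc α β) ∧
        (∀ᵐ s ∂volume.restrict (Ioo α β), f s = w (s • θ + (y : E d))) ∧
        ∃ z : frontier Ω, (z : E d) = β • θ + (y : E d) ∧ g z = f β

theorem isTraceOnLine_of_notMem_shadow (hy : y ∉ shadow Ω θ) : IsTraceOnLine Ω θ w g y := by
  have hslice := slice_eq_empty_of_notMem_shadow hy
  refine ⟨?_, fun α β hαβ => ?_⟩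
  · rw [hslice, memH1_iff, Measure.restrict_empty]
    refine ⟨memLp_measure_zero, 0, memLp_measure_zero, fun φ hφ => ?_⟩
    have hφ0 : φ = 0 := funext fun s => hφ.eq_zero_of_notMem (notMem_empty s)
    simp [hφ0]
  · obtain ⟨s, hs⟩ := exists_between hαβ.1
    exact absurd (hαβ.2.1 hs) (hslice ▸ notMem_empty s)

theorem isDirectionalTrace_iff_ae_isTraceOnLine :
    IsDirectionalTrace Ω θ u g ↔ ∃ w : E d → ℝ, w =ᵐ[volume.restrict Ω] u ∧
      ∀ᵐ y : H θ ∂hyperplaneMeasure θ, IsTraceOnLine Ω θ w g y := by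
  refine exists_congr fun w => and_congr_right fun _ => ⟨?_, fun h => ?_⟩
  · rintro ⟨A, -, hA, htrace⟩
    refine (measure_eq_zero_iff_ae_notMem.1 hA).mono fun y hyA => ?_
    by_cases hy : y ∈ shadow Ω θ
    · exact htrace y (by_contra fun h => hyA ⟨hy, h⟩)
    · exact isTraceOnLine_of_notMem_shadow hy
  · refine ⟨shadow Ω θ ∩ {y | IsTraceOnLine Ω θ w g y}, inter_subset_left, ?_, fun y hy => hy.2⟩
    rw [sdiff_self_inter]
    exact measure_mono_null (fun y hy => hy.2) (ae_iff.1 h)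

theorem IsTraceOnLine.congr (h : IsTraceOnLine Ω θ w g y) (hg : ∀ z ∈ lineExits Ω θ y, g' z = g z) :
    IsTraceOnLine Ω θ w g' y := by
  refine ⟨h.1, fun α β hαβ => ?_⟩
  obtain ⟨f, hf, hfw, z, hz, hgz⟩ := h.2 α β hαβ
  exact ⟨f, hf, hfw, z, hz, (hg z ⟨α, β, hαβ, hz⟩).trans hgz⟩

theorem IsTraceOnLine.eq_of_ae_eq (h : IsTraceOnLine Ω θ w g y) (h' : IsTraceOnLine Ω θ w' g' y)
    (hw : ∀ᵐ s : ℝ, s • θ + (y : E d) ∈ Ω → w (s • θ + (y : E d)) = w' (s • θ + (y : E d)))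
    {z : frontier Ω} (hz : z ∈ lineExits Ω θ y) : g z = g' z := by
  obtain ⟨α, β, hαβ, hzβ⟩ := hz
  obtain ⟨f, hf, hfw, z₁, hz₁, hgz⟩ := h.2 α β hαβ
  obtain ⟨f', hf', hfw', z₂, hz₂, hgz'⟩ := h'.2 α β hαβ
  obtain rfl : z₁ = z := Subtype.ext (hz₁.trans hzβ.symm)
  obtain rfl : z₂ = z₁ := Subtype.ext (hz₂.trans hzβ.symm)
  have hff' : f =ᵐ[volume.restrict (Ioc α β)] f' := by
    rw [← Measure.restrict_congr_set Ioo_ae_eq_Ioc]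
    filter_upwards [hfw, hfw', ae_restrict_of_ae hw, ae_restrict_mem measurableSet_Ioo]
      with s hs hs' hws hsI
    rw [hs, hs', hws (hαβ.2.1 hsI)]
  rw [hgz, hgz']
  exact Measure.eqOn_Ioc_of_ae_eq _ hff' hf hf' ⟨hαβ.1, le_rfl⟩

/-- The limit of the averages of `U` over the segments `[z - h θ, z]`, as `h → 0` along the sequence
`1 / (n + 1)`. It recovers the value at `z` of the continuous representative of `U` on the line in
the direction `θ` through `z`, and is Borel measurable in `z` without any choice of representative
on each line. -/
def averageLimit (θ : E d) (U : E d → ℝ) (z : E d) : ℝ :=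
  limUnder atTop fun n : ℕ =>
    (1 / ((n : ℝ) + 1))⁻¹ * ∫ t in Ioo 0 (1 / ((n : ℝ) + 1)), U (z - t • θ)

theorem measurable_averageLimit (hU : StronglyMeasurable U) : Measurable (averageLimit θ U) := by
  refine (StronglyMeasurable.limUnder fun n => StronglyMeasurable.const_mul ?_ _).measurable
  have hshift : Measurable fun p : E d × ℝ => p.1 - p.2 • θ := by fun_prop
  exact StronglyMeasurable.integral_prod_right (f := fun z (t : ℝ) => U (z - t • θ))
    (hU.comp_measurable hshift)

theorem averageLimit_eq {a b : ℝ} {F : ℝ → ℝ} (hab : a < b) (hF : ContinuousOn F (Ioc a b))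
    (hFU : ∀ᵐ s ∂volume.restrict (Ioo a b), F s = U (s • θ + (y : E d))) :
    averageLimit θ U (b • θ + (y : E d)) = F b := by
  have hpos : Tendsto (fun n : ℕ => 1 / ((n : ℝ) + 1)) atTop (𝓝[>] 0) :=
    tendsto_nhdsWithin_iff.2 ⟨tendsto_one_div_add_atTop_nhds_zero_nat,
      Eventually.of_forall fun _ => mem_Ioi.2 Nat.one_div_pos_of_nat⟩
  have hline (t : ℝ) : b • θ + (y : E d) - t • θ = (b - t) • θ + (y : E d) := by module
  refine Tendsto.limUnder_eq ?_
  simp only [hline]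
  exact (tendsto_average_left_of_continuousOn hab hF hFU).comp hpos

theorem isTraceOnLine_averageLimit (ho : IsOpen Ω) (hb : Bornology.IsBounded Ω) (hθ : ‖θ‖ = 1)
    (h : MemH1 (slice Ω θ y) fun s => U (s • θ + (y : E d))) :
    IsTraceOnLine Ω θ U (fun z => averageLimit θ U z) y := by
  refine ⟨h, fun α β hαβ => ?_⟩
  obtain ⟨F, hF, hFU⟩ := h.exists_continuousOn_ae_eq hαβ.1 hαβ.2.1
  have hF' := hF.mono Ioc_subset_Icc_self
  exact ⟨F, hF', hFU, ⟨_, endpoint_mem_frontier ho hb hθ hαβ⟩, rfl, averageLimit_eq hαβ.1 hF' hFU⟩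

theorem HasWeakDirDeriv.hasWeakLineDerivOn_indicator (h : HasWeakDirDeriv Ω θ u v)
    (ho : IsOpen Ω) : HasWeakLineDerivOn Ω θ (Ω.indicator u) (Ω.indicator v) := fun φ hφ => by
  have integral_indicator_mul (k χ : E d → ℝ) :
      ∫ x, Ω.indicator k x * χ x = ∫ x in Ω, k x * χ x := by
    simp only [← indicator_mul_left, integral_indicator ho.measurableSet]
  rw [integral_indicator_mul, integral_indicator_mul]
  exact h φ hφ

theorem HasWeakDirDeriv.ae_memH1_slice_indicator (h : HasWeakDirDeriv Ω θ u v) (ho : IsOpen Ω)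
    (hb : Bornology.IsBounded Ω) (hθ : ‖θ‖ = 1) :
    ∀ᵐ y : H θ ∂hyperplaneMeasure θ,
      MemH1 (slice Ω θ y) fun s => Ω.indicator u (s • θ + (y : E d)) := by
  have : IsFiniteMeasure (volume.restrict Ω) :=
    isFiniteMeasure_restrict.2 hb.measure_lt_top.ne
  have memLp (k : Lp ℝ 2 (volume.restrict Ω)) : MemLp (Ω.indicator k) 2 :=
    (memLp_indicator_iff_restrict ho.measurableSet).2 (Lp.memLp k)
  have integrable (k : Lp ℝ 2 (volume.restrict Ω)) : Integrable (Ω.indicator k) :=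
    (integrable_indicator_iff ho.measurableSet).2 ((Lp.memLp k).integrable one_le_two)
  exact (h.hasWeakLineDerivOn_indicator ho).ae_memH1_slice ho hθ (integrable u) (integrable v)
    (memLp u) (memLp v)

theorem IsDirectionalTrace.ae_eq (ho : IsOpen Ω) (hb : Bornology.IsBounded Ω) (hθ : ‖θ‖ = 1)
    (hg : IsDirectionalTrace Ω θ u g) (hg' : IsDirectionalTrace Ω θ u g') :
    ∀ᵐ z : frontier Ω ∂directionalMeasure Ω θ, g z = g' z := by
  obtain ⟨w, hw, htrace⟩ := isDirectionalTrace_iff_ae_isTraceOnLine.1 hg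
  obtain ⟨w', hw', htrace'⟩ := isDirectionalTrace_iff_ae_isTraceOnLine.1 hg'
  have hww' : ∀ᵐ x, x ∈ Ω → w x = w' x :=
    (ae_restrict_iff' ho.measurableSet).1 (hw.trans hw'.symm)
  refine ae_directionalMeasure_of_ae_lineExits ho hb hθ ?_
  filter_upwards [htrace, htrace', ae_ae_line hθ hww'] with y hy hy' hwy z hz
  exact hy.eq_of_ae_eq hy' hwy hz

theorem IsDirectionalTrace.congr_ae (ho : IsOpen Ω) (hb : Bornology.IsBounded Ω) (hθ : ‖θ‖ = 1)
    (hg : IsDirectionalTrace Ω θ u g)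
    (hgg' : ∀ᵐ z : frontier Ω ∂directionalMeasure Ω θ, g' z = g z) :
    IsDirectionalTrace Ω θ u g' := by
  obtain ⟨w, hw, htrace⟩ := isDirectionalTrace_iff_ae_isTraceOnLine.1 hg
  refine isDirectionalTrace_iff_ae_isTraceOnLine.2 ⟨w, hw, ?_⟩
  filter_upwards [htrace, ae_lineExits_of_ae_directionalMeasure ho hb hθ hgg'] with y hy hyg
  exact hy.congr hyg

theorem IsDirectionalTrace.iff_ae_eq (ho : IsOpen Ω) (hb : Bornology.IsBounded Ω) (hθ : ‖θ‖ = 1)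
    (hg : IsDirectionalTrace Ω θ u g) :
    IsDirectionalTrace Ω θ u g' ↔ ∀ᵐ z : frontier Ω ∂directionalMeasure Ω θ, g' z = g z :=
  ⟨fun hg' => hg'.ae_eq ho hb hθ hg, hg.congr_ae ho hb hθ⟩

theorem exists_measurable_isDirectionalTrace (ho : IsOpen Ω) (hb : Bornology.IsBounded Ω)
    (hθ : ‖θ‖ = 1) (hu : u ∈ W Ω θ) :
    ∃ g : frontier Ω → ℝ, Measurable g ∧ IsDirectionalTrace Ω θ u g := by
  obtain ⟨v, hv⟩ := hu
  have hmeas : StronglyMeasurable (Ω.indicator u) :=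
    (Lp.stronglyMeasurable u).indicator ho.measurableSet
  refine ⟨fun z => averageLimit θ (Ω.indicator u) z,
    (measurable_averageLimit hmeas).comp measurable_subtype_coe,
    isDirectionalTrace_iff_ae_isTraceOnLine.2
      ⟨_, indicator_ae_eq_restrict ho.measurableSet, ?_⟩⟩
  exact (hv.ae_memH1_slice_indicator ho hb hθ).mono fun y hy =>
    isTraceOnLine_averageLimit ho hb hθ hy

end Trace

end DirTrace

end

theorem mainTheorem5 {d : ℕ} (Ω : Set (DirTrace.E d)) (hΩ : IsOpen Ω)
    (hb : Bornology.IsBounded Ω) (θ : DirTrace.E d) (hθ : ‖θ‖ = 1)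
    (u : Lp ℝ 2 (volume.restrict Ω)) (hu : u ∈ DirTrace.W Ω θ) :
    (∀ g : frontier Ω → ℝ, DirTrace.IsDirectionalTrace Ω θ u g →
      ∀ g' : frontier Ω → ℝ, DirTrace.IsDirectionalTrace Ω θ u g' ↔
        ∀ᵐ z ∂(DirTrace.directionalMeasure Ω θ), g' z = g z) ∧
    ∃ g₀ : frontier Ω → ℝ, Measurable g₀ ∧
      DirTrace.directionalTrace Ω θ u =
        {g : frontier Ω → ℝ | ∀ᵐ z ∂(DirTrace.directionalMeasure Ω θ), g z = g₀ z} := by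
  obtain ⟨g₀, hmeas, hg₀⟩ := DirTrace.exists_measurable_isDirectionalTrace hΩ hb hθ hu
  exact ⟨fun g hg g' => hg.iff_ae_eq hΩ hb hθ, g₀, hmeas,
    Set.ext fun g => hg₀.iff_ae_eq hΩ hb hθ⟩
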